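/- All graphs are finite, simple and undirected. For graphs $F$ and $G$, say that $G$ is $F$-free if $G$ has no induced subgraph isomorphic to $F$. The clique-width of a non-empty graph $G$ is the minimum number of labels needed to construct $G$ by the following four operations: create a new graph consisting of a single labelled vertex; take the disjoint union of two labelled graphs; for two distinct labels $i \neq j$, add all edges between vertices with label $i$ and vertices with label $j$; and change every label $i$ to $j$. A disconnected graph has infinite diameter, and $P_4$ denotes the path on four vertices. Theorem. Let $d \geq 2$ be an integer and let $F$ be a graph. The class of non-empty $F$-free graphs of diameter at most $d$ has bounded clique-width (that is, there is a constant $c$ such that every graph in the class has clique-width at most $c$) if and only if $F$ is an induced subgraph of $P_4$ (that is, $F$ is isomorphic to an induced subgraph of $P_4$). -/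

import Mathlib

universe u v

/-- Clique-width expressions over the label set `Fin k`: create a single vertex with a label, take
a disjoint union, join all vertices of label `i` to all vertices of label `j` (for `i ≠ j`), and
relabel `i` to `j`. -/
inductive CliqueExpr (k : ℕ) : Type
  | vertex (i : Fin k) : CliqueExpr k
  | union (s t : CliqueExpr k) : CliqueExpr k
  | join (i j : Fin k) (hij : i ≠ j) (t : CliqueExpr k) : CliqueExpr k
  | relabel (i j : Fin k) (t : CliqueExpr k) : CliqueExpr k

namespace CliqueExpr

/-- The vertex type of the labelled graph built by an expression. -/
def Vert {k : ℕ} : CliqueExpr k → Type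
  | vertex _ => Unit
  | union s t => s.Vert ⊕ t.Vert
  | join _ _ _ t => t.Vert
  | relabel _ _ t => t.Vert

/-- The labelling of the labelled graph built by an expression. -/
def label {k : ℕ} : (e : CliqueExpr k) → e.Vert → Fin k
  | vertex i => fun _ => i
  | union s t => Sum.elim s.label t.label
  | join _ _ _ t => t.label
  | relabel i j t => fun v => if t.label v = i then j else t.label v

/-- The underlying graph of the labelled graph built by an expression. -/
def graph {k : ℕ} : (e : CliqueExpr k) → SimpleGraph e.Vert
  | vertex _ => (⊥ : SimpleGraph Unit)
  | union s t => SimpleGraph.sum s.graph t.graph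
  | join i j _ t =>
      t.graph ⊔ SimpleGraph.fromRel (fun v w => t.label v = i ∧ t.label w = j)
  | relabel _ _ t => t.graph

end CliqueExpr

/-- The clique-width of `G`: the least number `k` of labels for which some expression over `k`
labels builds a graph isomorphic to `G`. (It is `⊤` if there is none, which happens only
for the graph without vertices and for infinite graphs.) -/
noncomputable def cliqueWidth {V : Type u} (G : SimpleGraph V) : ℕ∞ :=
  sInf {c : ℕ∞ | ∃ k : ℕ, c = k ∧ ∃ e : CliqueExpr k, Nonempty (e.graph ≃g G)}

/-- A class of graphs, as a predicate on graphs, has bounded clique-width. -/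
def HasBoundedCliqueWidth (C : ∀ V : Type u, SimpleGraph V → Prop) : Prop :=
  ∃ c : ℕ, ∀ (V : Type u) (G : SimpleGraph V), C V G → cliqueWidth G ≤ c

/-- The class of (finite, non-empty) graphs `G` of diameter at most `d` that do not contain `F`
as an induced subgraph. The diameter of a disconnected graph is `⊤`. -/
def FreeOfDiamAtMost {W : Type v} (F : SimpleGraph W) (d : ℕ)
    (V : Type u) (G : SimpleGraph V) : Prop :=
  Finite V ∧ Nonempty V ∧ ¬ SimpleGraph.IsIndContained F G ∧ G.ediam ≤ d

/-! If `F` embeds in P₄, an `F`-free graph is P₄-free. By Seinsche's theorem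
(`NoInducedPath.splits`) it is then recursively a disjoint union or a complete join of smaller
pieces, so two labels suffice.

Conversely, incidence between points and pairs of points forces many labels whatever the other edges
are (`card_le_of_incidence`). These other edges can be chosen so that the diameter is at most 2 in
three ways: triangle-free, covered by two cliques, or split. Bounded clique-width puts `F` inside a
large graph of each kind. So `F` is split, with no triangle and no independent triple: its clique
and its independent side have at most two vertices each, and `F` embeds in P₄. -/

namespace CliqueExpr

/-! ### Balanced cuts and a lower bound on clique-width -/

instance finite_vert {k : ℕ} : (e : CliqueExpr k) → Finite e.Vert
  | vertex _ => inferInstanceAs (Finite Unit)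
  | union s t =>
    haveI := finite_vert s
    haveI := finite_vert t
    inferInstanceAs (Finite (s.Vert ⊕ t.Vert))
  | join _ _ _ t => finite_vert t
  | relabel _ _ t => finite_vert t

theorem join_adj {k : ℕ} {i j : Fin k} {hij : i ≠ j} {t : CliqueExpr k} {x y : t.Vert} :
    (join i j hij t).graph.Adj x y ↔ t.graph.Adj x y ∨
      x ≠ y ∧ (t.label x = i ∧ t.label y = j ∨ t.label y = i ∧ t.label x = j) :=
  Iff.rfl

/-- A colouring `c` of the set `Y` such that vertices of `Y` of the same colour have the same
label in `e` and the same neighbours outside `Y`. -/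
def IsCutColouring {k : ℕ} (e : CliqueExpr k) (Y : Set e.Vert) (c : e.Vert → Fin k) : Prop :=
  ∀ x ∈ Y, ∀ y ∈ Y, c x = c y → e.label x = e.label y ∧
    ∀ z ∉ Y, e.graph.Adj x z → e.graph.Adj y z

theorem IsCutColouring.inl {k : ℕ} {s t : CliqueExpr k} {Y : Set s.Vert} {c : s.Vert → Fin k}
    (h : s.IsCutColouring Y c) :
    (union s t).IsCutColouring (Sum.inl '' Y : Set (s.Vert ⊕ t.Vert)) (Sum.elim c t.label) := by
  rintro _ ⟨x, hx, rfl⟩ _ ⟨y, hy, rfl⟩ hc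
  obtain ⟨h1, h2⟩ := h x hx y hy hc
  refine ⟨h1, ?_⟩
  rintro (z | z) hz hadj
  · exact h2 z (fun hzY => hz ⟨z, hzY, rfl⟩) hadj
  · exact absurd hadj (by simp [graph])

theorem IsCutColouring.inr {k : ℕ} {s t : CliqueExpr k} {Y : Set t.Vert} {c : t.Vert → Fin k}
    (h : t.IsCutColouring Y c) :
    (union s t).IsCutColouring (Sum.inr '' Y : Set (s.Vert ⊕ t.Vert)) (Sum.elim s.label c) := by
  rintro _ ⟨x, hx, rfl⟩ _ ⟨y, hy, rfl⟩ hc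
  obtain ⟨h1, h2⟩ := h x hx y hy hc
  refine ⟨h1, ?_⟩
  rintro (z | z) hz hadj
  · exact absurd hadj (by simp [graph])
  · exact h2 z (fun hzY => hz ⟨z, hzY, rfl⟩) hadj

/-- Vertices of equal colour have equal labels, so a join gives both the same new neighbours outside
`Y`. -/
theorem IsCutColouring.join {k : ℕ} {t : CliqueExpr k} {Y : Set t.Vert} {c : t.Vert → Fin k}
    (h : t.IsCutColouring Y c) (i j : Fin k) (hij : i ≠ j) :
    (join i j hij t).IsCutColouring Y c := by
  intro x hx y hy hc
  obtain ⟨h1, h2⟩ := h x hx y hy hc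
  refine ⟨h1, fun z hz hadj => join_adj.2 ?_⟩
  rcases join_adj.1 hadj with hadj | ⟨-, hadj⟩
  · exact Or.inl (h2 z hz hadj)
  · exact Or.inr ⟨fun hyz => hz (hyz ▸ hy), h1 ▸ hadj⟩

theorem IsCutColouring.relabel {k : ℕ} {t : CliqueExpr k} {Y : Set t.Vert} {c : t.Vert → Fin k}
    (h : t.IsCutColouring Y c) (i j : Fin k) :
    (relabel i j t).IsCutColouring Y c := by
  intro x hx y hy hc
  obtain ⟨h1, h2⟩ := h x hx y hy hc
  exact ⟨by simp only [label, h1], h2⟩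

theorem isCutColouring_univ {k : ℕ} (e : CliqueExpr k) :
    e.IsCutColouring Set.univ e.label :=
  fun _ _ _ _ hc => ⟨hc, fun z hz => absurd (Set.mem_univ z) hz⟩

/-- Balanced cuts: a set `S` of more than `m` vertices has a part of size between `m + 1` and `2m`
that is cut out by a set whose vertices see the outside in at most `k` ways. -/
theorem exists_balanced_isCutColouring {k m : ℕ} (hm : 1 ≤ m) (e : CliqueExpr k)
    (S : Set e.Vert) (hS : m < S.ncard) :
    ∃ (Y : Set e.Vert) (c : e.Vert → Fin k), e.IsCutColouring Y c ∧
      m < (S ∩ Y).ncard ∧ (S ∩ Y).ncard ≤ 2 * m := by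
  by_cases hbig : S.ncard ≤ 2 * m
  · exact ⟨Set.univ, e.label, e.isCutColouring_univ, by simpa using hS, by simpa using hbig⟩
  induction e with
  | vertex i =>
    exfalso
    have h1 : Set.ncard (α := Unit) S ≤ 1 := by
      exact (Set.ncard_le_card _).trans (Nat.card_unique (α := Unit)).le
    exact absurd (h1.trans hm) (not_le.2 hS)
  | union s t ihs iht =>
    change Set (s.Vert ⊕ t.Vert) at S
    have hcard : S.ncard = (Sum.inl ⁻¹' S).ncard + (Sum.inr ⁻¹' S).ncard := by
      rw [← Set.ncard_image_of_injective _ (Sum.inl_injective (α := s.Vert) (β := t.Vert)),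
        ← Set.ncard_image_of_injective _ (Sum.inr_injective (α := s.Vert) (β := t.Vert)),
        ← Set.ncard_union_eq _ (Set.toFinite _) (Set.toFinite _), Set.image_preimage_inl_union_image_preimage_inr]
      rw [Set.disjoint_left]
      rintro _ ⟨x, -, rfl⟩ ⟨y, -, hy⟩
      cases hy
    -- Since `S` has more than `2 * m` elements, one side has more than `m`. That side is the cut if
    -- it has at most `2 * m`; otherwise the recursion enters it.
    by_cases hs : m < (Sum.inl ⁻¹' S).ncard
    · obtain ⟨Y, c, hY, h1, h2⟩ : ∃ (Y : Set s.Vert) (c : s.Vert → Fin k), s.IsCutColouring Y c ∧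
          m < ((Sum.inl ⁻¹' S) ∩ Y).ncard ∧ ((Sum.inl ⁻¹' S) ∩ Y).ncard ≤ 2 * m := by
        by_cases hb : (Sum.inl ⁻¹' S).ncard ≤ 2 * m
        · exact ⟨Set.univ, s.label, s.isCutColouring_univ, by simpa using hs, by simpa using hb⟩
        · exact ihs _ hs hb
      have : (S ∩ Sum.inl '' Y).ncard = ((Sum.inl ⁻¹' S) ∩ Y).ncard := by
        rw [← Set.ncard_image_of_injective _ (Sum.inl_injective (α := s.Vert) (β := t.Vert)),
          Set.image_preimage_inter]
      exact ⟨_, _, hY.inl (t := t), this ▸ h1, this ▸ h2⟩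
    · have ht : m < (Sum.inr ⁻¹' S).ncard := by
        by_contra hcon
        exact hbig (hcard.le.trans (by omega))
      obtain ⟨Y, c, hY, h1, h2⟩ : ∃ (Y : Set t.Vert) (c : t.Vert → Fin k), t.IsCutColouring Y c ∧
          m < ((Sum.inr ⁻¹' S) ∩ Y).ncard ∧ ((Sum.inr ⁻¹' S) ∩ Y).ncard ≤ 2 * m := by
        by_cases hb : (Sum.inr ⁻¹' S).ncard ≤ 2 * m
        · exact ⟨Set.univ, t.label, t.isCutColouring_univ, by simpa using ht, by simpa using hb⟩
        · exact iht _ ht hb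
      have : (S ∩ Sum.inr '' Y).ncard = ((Sum.inr ⁻¹' S) ∩ Y).ncard := by
        rw [← Set.ncard_image_of_injective _ (Sum.inr_injective (α := s.Vert) (β := t.Vert)),
          Set.image_preimage_inter]
      exact ⟨_, _, hY.inr (s := s), this ▸ h1, this ▸ h2⟩
  | join i j hij t ih =>
    obtain ⟨Y, c, hY, h⟩ := ih S hS hbig
    exact ⟨Y, c, hY.join i j hij, h⟩
  | relabel i j t ih =>
    obtain ⟨Y, c, hY, h⟩ := ih S hS hbig
    exact ⟨Y, c, hY.relabel i j, h⟩

/-- A graph in which vertices `f a` and `g x y` are joined exactly if `a ∈ {x, y}` needs many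
labels. -/
theorem card_le_of_incidence {k m : ℕ} (hm : 1 ≤ m) (hk : k ≤ m) (e : CliqueExpr k)
    {A : Type u} [Finite A] (f : A → e.Vert) (hf : f.Injective) (g : A → A → e.Vert)
    (hfg : ∀ a x y, e.graph.Adj (f a) (g x y) ↔ a = x ∨ a = y) :
    Nat.card A ≤ 3 * m := by
  by_contra! hA
  have hrange : (Set.range f).ncard = Nat.card A := by
    rw [← Set.image_univ, Set.ncard_image_of_injective _ hf, Set.ncard_univ]
  obtain ⟨Y, c, hY, h1, h2⟩ := e.exists_balanced_isCutColouring hm (Set.range f) (by omega)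
  have hpre : (Set.range f ∩ Y).ncard = (f ⁻¹' Y).ncard := by
    rw [← Set.ncard_image_of_injective _ hf, Set.image_preimage_eq_range_inter]
  rw [hpre] at h1 h2
  have hcompl : (f ⁻¹' Y).ncard + (f ⁻¹' Y)ᶜ.ncard = Nat.card A :=
    Set.ncard_add_ncard_compl _
  have pigeon (s : Set A) (hs : m < s.ncard) (φ : A → Fin k) : ¬ Set.InjOn φ s := by
    intro hφ
    have := hφ.ncard_image
    have h3 := Set.ncard_le_card (s := φ '' s)
    simp only [Nat.card_eq_fintype_card, Fintype.card_fin] at h3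
    omega
  -- Otherwise each inner point `a` has a pair `g a y` outside `Y` with `y` outer. An inner point of
  -- the same colour also sees this pair, hence equals `a`: too many colours.
  obtain ⟨a, ha, hag⟩ : ∃ a ∈ f ⁻¹' Y, ∀ y ∉ f ⁻¹' Y, g a y ∈ Y := by
    by_contra! hcon
    refine pigeon _ h1 (c ∘ f) fun a ha b hb hab => ?_
    obtain ⟨y, hy, hay⟩ := hcon a ha
    have := (hY _ ha _ hb hab).2 _ hay ((hfg _ _ _).2 (Or.inl rfl))
    rcases (hfg _ _ _).1 this with h | h
    · exact h.symm
    · exact absurd (h ▸ hb) hy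
  -- For this `a`, the pairs `g a y` with `y` outer lie in `Y`. They are told apart by the outer
  -- points `f y`, so again more than `k` colours are needed.
  refine pigeon (f ⁻¹' Y)ᶜ (by omega) (fun y => c (g a y)) fun y hy z hz hyz => ?_
  have := (hY _ (hag y hy) _ (hag z hz) hyz).2 _ hy ((hfg _ _ _).2 (Or.inr rfl)).symm
  rcases (hfg _ _ _).1 this.symm with h | h
  · exact absurd (h ▸ ha) hy
  · exact h

end CliqueExpr

theorem exists_cliqueExpr_of_cliqueWidth_le {V : Type u} {G : SimpleGraph V} {c : ℕ}
    (h : cliqueWidth G ≤ c) : ∃ k ≤ c, ∃ e : CliqueExpr k, Nonempty (e.graph ≃g G) := by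
  have hne : {c : ℕ∞ | ∃ k : ℕ, c = k ∧ ∃ e : CliqueExpr k, Nonempty (e.graph ≃g G)}.Nonempty := by
    by_contra hemp
    rw [Set.not_nonempty_iff_eq_empty] at hemp
    rw [cliqueWidth, hemp, sInf_empty] at h
    exact absurd h (by simp)
  obtain ⟨k, hk, e, he⟩ := csInf_mem hne
  refine ⟨k, ?_, e, he⟩
  rw [cliqueWidth, hk] at h
  exact_mod_cast h

theorem card_le_of_cliqueWidth_le {V : Type u} {G : SimpleGraph V} {c : ℕ}
    (h : cliqueWidth G ≤ c) {A : Type u} [Finite A] (f : A → V) (hf : f.Injective) (g : A → A → V)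
    (hfg : ∀ a x y, G.Adj (f a) (g x y) ↔ a = x ∨ a = y) :
    Nat.card A ≤ 3 * (c + 1) := by
  obtain ⟨k, hk, e, ⟨φ⟩⟩ := exists_cliqueExpr_of_cliqueWidth_le h
  -- Here `m = c + 1`, which is positive even when `c = 0`.
  refine e.card_le_of_incidence (by omega) (by omega) (φ.symm ∘ f)
    (φ.symm.injective.comp hf) (fun x y => φ.symm (g x y)) fun a x y => ?_
  rw [← hfg a x y]
  exact φ.symm.map_adj_iff

/-! ### Seinsche's theorem -/

namespace SimpleGraph

/-- No four vertices induce a path. -/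
def NoInducedPath {V : Type u} (G : SimpleGraph V) : Prop :=
  ∀ x y z w, G.Adj x y → G.Adj y z → G.Adj z w → ¬ G.Adj x z → ¬ G.Adj x w → G.Adj y w

theorem noInducedPath_of_not_isIndContained {V : Type u} {G : SimpleGraph V}
    (h : ¬ IsIndContained (pathGraph 4) G) : G.NoInducedPath := by
  intro x y z w hxy hyz hzw hxz hxw
  by_contra hyw
  have hxz' : x ≠ z := by rintro rfl; exact hxw hzw
  have hxw' : x ≠ w := by rintro rfl; exact hxz hzw.symm
  have hyw' : y ≠ w := by rintro rfl; exact hxw hxy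
  refine h ⟨⟨⟨![x, y, z, w], ?_⟩, fun {i j} => ?_⟩⟩
  · intro i j
    fin_cases i <;> fin_cases j <;>
      simp [hxy.ne, hyz.ne, hzw.ne, hxz', hxw', hyw', hxy.ne', hyz.ne', hzw.ne', hxz'.symm,
        hxw'.symm, hyw'.symm]
  · change G.Adj (![x, y, z, w] i) (![x, y, z, w] j) ↔ _
    fin_cases i <;> fin_cases j <;>
      simp [pathGraph_adj, hxy, hyz, hzw, hxz, hxw, hyw, hxy.symm, hyz.symm, hzw.symm,
        G.adj_comm z x, G.adj_comm w x, G.adj_comm w y]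

/-- P₄ is self-complementary: a path `x y z w` in the complement is the path `z x w y` in `G`. -/
theorem NoInducedPath.compl {V : Type u} {G : SimpleGraph V} (h : G.NoInducedPath) :
    Gᶜ.NoInducedPath := by
  intro x y z w hxy hyz hzw hxz hxw
  by_contra hyw
  simp only [compl_adj, not_and, not_not] at hxy hyz hzw hxz hxw hyw
  have hxz' : x ≠ z := by rintro rfl; exact hzw.2 (hxw hzw.1)
  have hxw' : x ≠ w := by rintro rfl; exact hzw.2 (hxz hxz').symm
  have hyw' : y ≠ w := by rintro rfl; exact hxy.2 (hxw hxw')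
  exact hxy.2 (h z x w y (hxz hxz').symm (hxw hxw') (hyw hyw').symm hzw.2
    (fun hzy => hyz.2 hzy.symm))

/-- `U` splits into two non-empty parts with no edges between them. -/
def Splits {V : Type u} [DecidableEq V] (G : SimpleGraph V) (U : Finset V) : Prop :=
  ∃ S T : Finset V, S.Nonempty ∧ T.Nonempty ∧ Disjoint S T ∧ S ∪ T = U ∧
    ∀ x ∈ S, ∀ y ∈ T, ¬ G.Adj x y

/-- If `v` has a neighbour `t ∈ T`, the non-neighbours of `v` in `S` split off: an edge from one of
them, `x`, to a neighbour `y ∈ S` of `v` would give the induced path `x y v t`. Otherwise `v` joins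
`S`. -/
theorem NoInducedPath.splits_insert_of_nonadj {V : Type u} [DecidableEq V] {G : SimpleGraph V}
    (h : G.NoInducedPath) {S T : Finset V} {v u : V} (hv : v ∉ S ∪ T) (hST : Disjoint S T)
    (hT : T.Nonempty) (hadj : ∀ x ∈ S, ∀ y ∈ T, ¬ G.Adj x y) (hu : u ∈ S) (huv : ¬ G.Adj v u) :
    G.Splits (insert v (S ∪ T)) := by
  classical
  simp only [Finset.mem_union, not_or] at hv
  by_cases hvT : ∃ t ∈ T, G.Adj v t
  · obtain ⟨t, ht, hvt⟩ := hvT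
    refine ⟨{x ∈ S | ¬ G.Adj v x}, insert v ({x ∈ S | G.Adj v x} ∪ T), ⟨u, by simp [hu, huv]⟩,
      ⟨v, by simp⟩, ?_, ?_, ?_⟩
    · rw [Finset.disjoint_left] at hST ⊢
      grind
    · grind
    · intro x hx y hy hxy
      simp only [Finset.mem_filter, Finset.mem_insert, Finset.mem_union] at hx hy
      rcases hy with rfl | ⟨hyS, hvy⟩ | hyT
      · exact hx.2 hxy.symm
      · exact hadj y hyS t ht (h x y v t hxy hvy.symm hvt (fun hxv => hx.2 hxv.symm)
          (hadj x hx.1 t ht))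
      · exact hadj x hx.1 y hyT hxy
  · push Not at hvT
    refine ⟨insert v S, T, ⟨v, by simp⟩, hT, ?_, by simp, ?_⟩
    · rw [Finset.disjoint_left] at hST ⊢
      grind
    · intro x hx y hy
      rcases Finset.mem_insert.1 hx with rfl | hx
      · exact hvT y hy
      · exact hadj x hx y hy

theorem NoInducedPath.splits_insert {V : Type u} [DecidableEq V] {G : SimpleGraph V}
    (h : G.NoInducedPath) {U : Finset V} {v : V} (hv : v ∉ U) (hU : G.Splits U) :
    G.Splits (insert v U) ∨ Gᶜ.Splits (insert v U) := by
  obtain ⟨S, T, hS, hT, hST, rfl, hadj⟩ := hU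
  by_cases hall : ∀ u ∈ S ∪ T, G.Adj v u
  · refine Or.inr ⟨{v}, S ∪ T, by simp, hS.mono Finset.subset_union_left, by simpa using hv,
      Finset.singleton_union _ _, ?_⟩
    intro x hx y hy hxy
    rw [Finset.mem_singleton] at hx
    subst hx
    exact hxy.2 (hall y hy)
  · push Not at hall
    obtain ⟨u, hu, huv⟩ := hall
    refine Or.inl ?_
    rcases Finset.mem_union.1 hu with hu | hu
    · exact h.splits_insert_of_nonadj hv hST hT hadj hu huv
    · rw [Finset.union_comm] at hv ⊢
      exact h.splits_insert_of_nonadj hv hST.symm hS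
        (fun x hx y hy hxy => hadj y hy x hx hxy.symm) hu huv

/-- Seinsche's theorem: a `P₄`-free graph on at least two vertices is disconnected or
co-disconnected. -/
theorem NoInducedPath.splits {V : Type u} [DecidableEq V] {G : SimpleGraph V}
    (h : G.NoInducedPath) (U : Finset V) (hU : 1 < U.card) : G.Splits U ∨ Gᶜ.Splits U := by
  induction U using Finset.induction_on with
  | empty => simp at hU
  | insert v U hv ih =>
    rw [Finset.card_insert_of_notMem hv] at hU
    by_cases h1 : 1 < U.card
    · rcases ih h1 with h2 | h2
      · exact h.splits_insert hv h2
      · have := h.compl.splits_insert hv h2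
        rw [compl_compl] at this
        exact this.symm
    · obtain ⟨w, rfl⟩ := Finset.card_eq_one.1 (by omega : U.card = 1)
      have hd : Disjoint ({v} : Finset V) {w} := by simpa using hv
      by_cases hvw : G.Adj v w
      · exact Or.inr ⟨{v}, {w}, by simp, by simp, hd, rfl, by simp [hvw]⟩
      · exact Or.inl ⟨{v}, {w}, by simp, by simp, hd, rfl, by simp [hvw]⟩

end SimpleGraph

/-! ### Two-label expressions for P₄-free graphs -/

namespace CliqueExpr

/-- `φ` identifies the graph built by `e` with the subgraph of `G` induced by `U`. -/
structure Builds {k : ℕ} {V : Type u} (e : CliqueExpr k) (G : SimpleGraph V) (U : Finset V)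
    (φ : e.Vert → V) : Prop where
  injective : φ.Injective
  mem_iff : ∀ v, v ∈ U ↔ ∃ x, φ x = v
  adj_iff : ∀ x y, e.graph.Adj x y ↔ G.Adj (φ x) (φ y)

theorem Builds.injective_elim {k l : ℕ} {V : Type u} {G : SimpleGraph V} {S T : Finset V}
    (hST : Disjoint S T) {s : CliqueExpr k} {t : CliqueExpr l} {φ : s.Vert → V} {ψ : t.Vert → V}
    (hs : s.Builds G S φ) (ht : t.Builds G T ψ) : (Sum.elim φ ψ).Injective :=
  hs.injective.sumElim ht.injective fun x y hxy =>
    Finset.disjoint_left.1 hST ((hs.mem_iff _).2 ⟨x, rfl⟩) ((ht.mem_iff _).2 ⟨y, hxy.symm⟩)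

/-- Keeping every finished piece at label 0 leaves label 1 free to mark one side during a complete
join. -/
theorem exists_builds {V : Type u} {G : SimpleGraph V} (h : G.NoInducedPath)
    (n : ℕ) (U : Finset V) (hn : U.card ≤ n) (hU : U.Nonempty) :
    ∃ (e : CliqueExpr 2) (φ : e.Vert → V), e.Builds G U φ ∧ ∀ x, e.label x = 0 := by
  classical
  induction n generalizing U with
  | zero => exact absurd (Finset.card_pos.2 hU) (by omega)
  | succ n ih =>
    by_cases hcard : 1 < U.card
    · have parts {S T : Finset V} (hS : S.Nonempty) (hT : T.Nonempty) (hST : Disjoint S T)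
          (hSTU : S ∪ T = U) : S.card ≤ n ∧ T.card ≤ n := by
        have := Finset.card_union_of_disjoint hST
        rw [hSTU] at this
        have := hS.card_pos
        have := hT.card_pos
        omega
      rcases h.splits U hcard with ⟨S, T, hS, hT, hST, hSTU, hadj⟩ | ⟨S, T, hS, hT, hST, hSTU, hadj⟩
      · obtain ⟨hSn, hTn⟩ := parts hS hT hST hSTU
        obtain ⟨s, φ, hs, hs0⟩ := ih S hSn hS
        obtain ⟨t, ψ, ht, ht0⟩ := ih T hTn hT
        have key (x y) : ¬ G.Adj (φ x) (ψ y) :=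
          hadj _ ((hs.mem_iff _).2 ⟨x, rfl⟩) _ ((ht.mem_iff _).2 ⟨y, rfl⟩)
        refine ⟨union s t, Sum.elim φ ψ, ⟨hs.injective_elim hST ht, fun v => ?_, ?_⟩, ?_⟩
        · rw [← hSTU, Finset.mem_union, hs.mem_iff, ht.mem_iff]
          exact (Sum.exists (p := fun a => Sum.elim φ ψ a = v)).symm
        · rintro (x | x) (y | y)
          · exact hs.adj_iff x y
          · simp [graph, key]
          · simp [graph, key, G.adj_comm (ψ x)]
          · exact ht.adj_iff x y
        · rintro (x | x)
          · exact hs0 x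
          · exact ht0 x
      · obtain ⟨hSn, hTn⟩ := parts hS hT hST hSTU
        obtain ⟨s, φ, hs, hs0⟩ := ih S hSn hS
        obtain ⟨t, ψ, ht, ht0⟩ := ih T hTn hT
        have key (x y) : G.Adj (φ x) (ψ y) := by
          have hx := (hs.mem_iff _).2 ⟨x, rfl⟩
          have hy := (ht.mem_iff _).2 ⟨y, rfl⟩
          have := hadj _ hx _ hy
          by_contra hcon
          exact this ⟨fun heq => Finset.disjoint_left.1 hST hx (heq ▸ hy), hcon⟩
        refine ⟨relabel 1 0 (join 0 1 (by decide) (union s (relabel 0 1 t))), Sum.elim φ ψ,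
          ⟨hs.injective_elim hST ht, fun v => ?_, ?_⟩, ?_⟩
        · rw [← hSTU, Finset.mem_union, hs.mem_iff, ht.mem_iff]
          exact (Sum.exists (p := fun a => Sum.elim φ ψ a = v)).symm
        · have hl (x : s.Vert) : (union s (relabel 0 1 t)).label (Sum.inl x) = 0 := hs0 x
          have hr (y : t.Vert) : (union s (relabel 0 1 t)).label (Sum.inr y) = 1 := if_pos (ht0 y)
          rintro (x | x) (y | y)
          · refine (join_adj.trans (or_iff_left ?_)).trans (hs.adj_iff x y)
            rintro ⟨-, ⟨-, h1⟩ | ⟨-, h1⟩⟩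
            · exact zero_ne_one ((hl y).symm.trans h1)
            · exact zero_ne_one ((hl x).symm.trans h1)
          · exact iff_of_true (join_adj.2 (Or.inr ⟨Sum.inl_ne_inr, Or.inl ⟨hl x, hr y⟩⟩)) (key x y)
          · exact iff_of_true (join_adj.2 (Or.inr ⟨Sum.inr_ne_inl, Or.inr ⟨hl y, hr x⟩⟩))
              (key y x).symm
          · refine (join_adj.trans (or_iff_left ?_)).trans (ht.adj_iff x y)
            rintro ⟨-, ⟨h1, -⟩ | ⟨h1, -⟩⟩
            · exact one_ne_zero ((hr x).symm.trans h1)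
            · exact one_ne_zero ((hr y).symm.trans h1)
        · rintro (x | x)
          · simp [label, hs0]
          · have := ht0 x
            simp [label, this]
    · obtain ⟨w, rfl⟩ := Finset.card_eq_one.1 (le_antisymm (by omega) (Finset.card_pos.2 hU))
      refine ⟨vertex 0, fun _ => w, ⟨fun x y _ => rfl, fun v => ?_, fun x y => ?_⟩, fun _ => rfl⟩
      · rw [Finset.mem_singleton]
        exact ⟨fun hv => ⟨(), hv.symm⟩, fun ⟨_, hv⟩ => hv.symm⟩
      · exact iff_of_false id (G.loopless.irrefl w)

end CliqueExpr

theorem cliqueWidth_le_two {V : Type u} [Finite V] [Nonempty V] {G : SimpleGraph V}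
    (h : G.NoInducedPath) : cliqueWidth G ≤ 2 := by
  have := Fintype.ofFinite V
  obtain ⟨e, φ, he, -⟩ := CliqueExpr.exists_builds h _ Finset.univ le_rfl Finset.univ_nonempty
  have hb : φ.Bijective := ⟨he.injective, fun v => (he.mem_iff v).1 (Finset.mem_univ v)⟩
  exact sInf_le ⟨2, rfl, e, ⟨⟨Equiv.ofBijective φ hb, fun {x y} => (he.adj_iff x y).symm⟩⟩⟩

/-! ### Incidence graphs of diameter at most two -/

namespace SimpleGraph

theorem ediam_le_two {V : Type u} {G : SimpleGraph V}
    (h : ∀ u v, u = v ∨ G.Adj u v ∨ ∃ w, G.Adj u w ∧ G.Adj w v) : G.ediam ≤ 2 := by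
  refine ediam_le_of_edist_le fun u v => ?_
  rcases h u v with rfl | h | ⟨w, h1, h2⟩
  · simp
  · exact (edist_le (Walk.cons h .nil)).trans (by norm_num)
  · exact (edist_le (Walk.cons h1 (.cons h2 .nil))).trans (by norm_num)

/-- The incidence graph of points `a : A` and pairs `(x, y) : A × A`, in which the pairs form a
clique, and so do the points if `p` holds. -/
def cliqueIncidence (A : Type u) (p : Prop) : SimpleGraph (A ⊕ A × A) where
  Adj
    | .inl a, .inl b => p ∧ a ≠ b
    | .inl a, .inr x => a = x.1 ∨ a = x.2
    | .inr x, .inl a => a = x.1 ∨ a = x.2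
    | .inr x, .inr y => x ≠ y
  symm := ⟨by
    rintro (a | x) (b | y) h
    · exact ⟨h.1, h.2.symm⟩
    · exact h
    · exact h
    · exact Ne.symm h⟩
  loopless := ⟨by
    rintro (a | x) h
    · exact h.2 rfl
    · exact h rfl⟩

theorem ediam_cliqueIncidence_le (A : Type u) (p : Prop) : (cliqueIncidence A p).ediam ≤ 2 := by
  refine ediam_le_two ?_
  have key (a : A) (x : A × A) : (cliqueIncidence A p).Adj (.inl a) (.inr x) ∨
      ∃ w, (cliqueIncidence A p).Adj (.inl a) w ∧ (cliqueIncidence A p).Adj w (.inr x) := by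
    by_cases h : x = (a, a)
    · exact Or.inl (h ▸ Or.inl rfl)
    · exact Or.inr ⟨.inr (a, a), Or.inl rfl, Ne.symm h⟩
  rintro (a | x) (b | y)
  · exact Or.inr (Or.inr ⟨.inr (a, b), Or.inl rfl, Or.inr rfl⟩)
  · exact Or.inr (key a y)
  · refine Or.inr ((key b x).imp (fun h => h.symm) fun ⟨w, h1, h2⟩ => ⟨w, h2.symm, h1.symm⟩)
  · by_cases h : x = y
    · exact Or.inl (h ▸ rfl)
    · exact Or.inr (Or.inl h)

/-- Points, copies of the points and pairs of points: a point is joined to its copy and to the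
pairs containing it, and its copy is joined to the pairs not containing it. -/
def triangleFreeIncidence (A : Type u) : SimpleGraph ((A ⊕ A) ⊕ A × A) where
  Adj
    | .inl (.inl a), .inl (.inr b) => a = b
    | .inl (.inr a), .inl (.inl b) => a = b
    | .inl (.inl a), .inr x => a = x.1 ∨ a = x.2
    | .inr x, .inl (.inl a) => a = x.1 ∨ a = x.2
    | .inl (.inr a), .inr x => ¬ (a = x.1 ∨ a = x.2)
    | .inr x, .inl (.inr a) => ¬ (a = x.1 ∨ a = x.2)
    | _, _ => False
  symm := ⟨by
    rintro ((a | a) | x) ((b | b) | y) h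
    all_goals first | exact h | exact Eq.symm h⟩
  loopless := ⟨by
    rintro ((a | a) | x) h <;> exact h⟩

/-- A point and its copy have complementary neighbourhoods among the pairs, so each reaches through
the other the pairs it misses. Two pairs involve at most four points; the copy of a fifth is
adjacent to both. -/
theorem ediam_triangleFreeIncidence_le (A : Type u) [Finite A] (hA : 5 ≤ Nat.card A) :
    (triangleFreeIncidence A).ediam ≤ 2 := by
  classical
  have := Fintype.ofFinite A
  rw [Nat.card_eq_fintype_card] at hA
  have fresh (a b c d : A) : ∃ e, e ≠ a ∧ e ≠ b ∧ e ≠ c ∧ e ≠ d := by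
    obtain ⟨e, he⟩ : ∃ e, e ∉ ({a, b, c, d} : Finset A) := by
      by_contra! hcon
      have h1 := Finset.card_le_four (a := a) (b := b) (c := c) (d := d)
      rw [Finset.eq_univ_iff_forall.2 hcon, Finset.card_univ] at h1
      omega
    exact ⟨e, by simpa using he⟩
  set G := triangleFreeIncidence A
  have key1 (a b : A) : G.Adj (.inl (.inl a)) (.inl (.inr b)) ∨
      ∃ w, G.Adj (.inl (.inl a)) w ∧ G.Adj w (.inl (.inr b)) := by
    by_cases h : a = b
    · exact Or.inl h
    · exact Or.inr ⟨.inr (a, a), Or.inl rfl, fun hb => h (by tauto)⟩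
  have key2 (a : A) (x : A × A) : G.Adj (.inl (.inl a)) (.inr x) ∨
      ∃ w, G.Adj (.inl (.inl a)) w ∧ G.Adj w (.inr x) := by
    by_cases h : a = x.1 ∨ a = x.2
    · exact Or.inl h
    · exact Or.inr ⟨.inl (.inr a), rfl, h⟩
  have key3 (a : A) (x : A × A) : G.Adj (.inl (.inr a)) (.inr x) ∨
      ∃ w, G.Adj (.inl (.inr a)) w ∧ G.Adj w (.inr x) := by
    by_cases h : a = x.1 ∨ a = x.2
    · exact Or.inr ⟨.inl (.inl a), rfl, h⟩
    · exact Or.inl h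
  have flip {u v} (h : G.Adj u v ∨ ∃ w, G.Adj u w ∧ G.Adj w v) :
      G.Adj v u ∨ ∃ w, G.Adj v w ∧ G.Adj w u :=
    h.imp (fun h => h.symm) fun ⟨w, h1, h2⟩ => ⟨w, h2.symm, h1.symm⟩
  refine ediam_le_two ?_
  rintro ((a | a) | x) ((b | b) | y)
  · exact Or.inr (Or.inr ⟨.inr (a, b), Or.inl rfl, Or.inr rfl⟩)
  · exact Or.inr (key1 a b)
  · exact Or.inr (key2 a y)
  · exact Or.inr (flip (key1 b a))
  · obtain ⟨e, h1, h2, -⟩ := fresh a b a b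
    exact Or.inr (Or.inr ⟨.inr (e, e), fun h => h1 (by tauto), fun h => h2 (by tauto)⟩)
  · exact Or.inr (key3 a y)
  · exact Or.inr (flip (key2 b x))
  · exact Or.inr (flip (key3 b x))
  · obtain ⟨e, h1, h2, h3, h4⟩ := fresh x.1 x.2 y.1 y.2
    exact Or.inr (Or.inr ⟨.inl (.inr e), not_or.2 ⟨h1, h2⟩, not_or.2 ⟨h3, h4⟩⟩)

/-- Points, copies and pairs are independent sets, and a point and its own copy have no common pair.
-/
theorem triangleFreeIncidence_not_triangle {A : Type u} (u v w : (A ⊕ A) ⊕ A × A)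
    (huv : (triangleFreeIncidence A).Adj u v) (hvw : (triangleFreeIncidence A).Adj v w)
    (huw : (triangleFreeIncidence A).Adj u w) : False := by
  rcases u with (a | a) | x <;> rcases v with (b | b) | y <;> rcases w with (c | c) | z <;>
    simp only [triangleFreeIncidence] at huv hvw huw <;> grind

theorem cliqueIncidence_not_anticlique {A : Type u} (u v w : A ⊕ A × A)
    (huv : u ≠ v) (hvw : v ≠ w) (huw : u ≠ w) :
    (cliqueIncidence A True).Adj u v ∨ (cliqueIncidence A True).Adj v w ∨
      (cliqueIncidence A True).Adj u w := by
  rcases u with a | x <;> rcases v with b | y <;> rcases w with c | z <;>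
    simp only [cliqueIncidence] <;> grind

/-! ### Small graphs that embed in P₄ -/

theorem isIndContained_pathGraph_of_injective {W : Type v} {F : SimpleGraph W} (φ : W → Fin 4)
    (hφ : φ.Injective) (h : ∀ u v, F.Adj u v ↔ (pathGraph 4).Adj (φ u) (φ v)) :
    IsIndContained F (pathGraph 4) :=
  ⟨⟨⟨φ, hφ⟩, fun {u v} => (h u v).symm⟩⟩

theorem isIndContained_pathGraph_of_three {W : Type v} {F : SimpleGraph W} {x y z : W}
    (hW : ∀ w, w = x ∨ w = y ∨ w = z) (hxy : F.Adj x y) (hyz : y ≠ z) (hxz' : x ≠ z)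
    (hxz : ¬ F.Adj x z) : IsIndContained F (pathGraph 4) := by
  classical
  have hne := hxy.ne
  have hyx := hxy.symm
  have hzx : ¬ F.Adj z x := fun h => hxz h.symm
  by_cases h : F.Adj y z
  · have h' := h.symm
    refine isIndContained_pathGraph_of_injective
      (fun w => if w = x then 0 else if w = y then 1 else 2) ?_ ?_
    · intro u v huv
      have := hW u
      have := hW v
      grind
    · intro u v
      rcases hW u with rfl | rfl | rfl <;> rcases hW v with rfl | rfl | rfl <;>
        simp_all [pathGraph_adj, Ne.symm]
  · have h' : ¬ F.Adj z y := fun h' => h h'.symm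
    refine isIndContained_pathGraph_of_injective
      (fun w => if w = x then 0 else if w = y then 1 else 3) ?_ ?_
    · intro u v huv
      have := hW u
      have := hW v
      grind
    · intro u v
      rcases hW u with rfl | rfl | rfl <;> rcases hW v with rfl | rfl | rfl <;>
        simp_all [pathGraph_adj, Ne.symm]

theorem isIndContained_pathGraph_of_four {W : Type v} {F : SimpleGraph W} {x y z t : W}
    (hW : ∀ w, w = x ∨ w = y ∨ w = z ∨ w = t) (hxy : F.Adj x y) (hyz : F.Adj y z)
    (hzt : F.Adj z t) (hxz : ¬ F.Adj x z) (hxt : ¬ F.Adj x t) (hyt : ¬ F.Adj y t) :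
    IsIndContained F (pathGraph 4) := by
  classical
  have h1 := hxy.ne
  have h2 := hyz.ne
  have h3 := hzt.ne
  have h4 : x ≠ z := by rintro rfl; exact hxt hzt
  have h5 : x ≠ t := by rintro rfl; exact hxz hzt.symm
  have h6 : y ≠ t := by rintro rfl; exact hxt hxy
  have hyx := hxy.symm
  have hzy := hyz.symm
  have htz := hzt.symm
  have hzx : ¬ F.Adj z x := fun h => hxz h.symm
  have htx : ¬ F.Adj t x := fun h => hxt h.symm
  have hty : ¬ F.Adj t y := fun h => hyt h.symm
  refine isIndContained_pathGraph_of_injective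
    (fun w => if w = x then 0 else if w = y then 1 else if w = z then 2 else 3) ?_ ?_
  · intro u v huv
    have := hW u
    have := hW v
    grind
  · intro u v
    rcases hW u with rfl | rfl | rfl | rfl <;> rcases hW v with rfl | rfl | rfl | rfl <;>
      simp_all [pathGraph_adj, Ne.symm]

theorem isIndContained_pathGraph_of_two {W : Type v} {F : SimpleGraph W} {x y : W}
    (hW : ∀ w, w = x ∨ w = y) : IsIndContained F (pathGraph 4) := by
  classical
  by_cases h : F.Adj x y
  · have h' := h.symm
    have hne := h.ne
    refine isIndContained_pathGraph_of_injective (fun w => if w = x then 0 else 1) ?_ ?_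
    · intro u v huv
      have := hW u
      have := hW v
      grind
    · intro u v
      rcases hW u with rfl | rfl <;> rcases hW v with rfl | rfl <;>
        simp_all [pathGraph_adj, Ne.symm]
  · have h' : ¬ F.Adj y x := fun h' => h h'.symm
    refine isIndContained_pathGraph_of_injective (fun w => if w = x then 0 else 2) ?_ ?_
    · intro u v huv
      have := hW u
      have := hW v
      grind
    · intro u v
      by_cases hne : x = y
      · subst hne
        simp_all
      · rcases hW u with rfl | rfl <;> rcases hW v with rfl | rfl <;>
          simp_all [pathGraph_adj, Ne.symm]

/-- A split graph without triangles and without independent triples embeds in `P₄`. -/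
theorem isIndContained_pathGraph_of_split {W : Type v} {F : SimpleGraph W}
    (htri : ∀ u v w, F.Adj u v → F.Adj v w → F.Adj u w → False)
    (hanti : ∀ u v w, u ≠ v → v ≠ w → u ≠ w → F.Adj u v ∨ F.Adj v w ∨ F.Adj u w)
    (K : W → Prop) (hK : ∀ u v, K u → K v → u ≠ v → F.Adj u v)
    (hI : ∀ u v, ¬ K u → ¬ K v → ¬ F.Adj u v) : IsIndContained F (pathGraph 4) := by
  have hK3 (u v w) (hu : K u) (hv : K v) (hw : K w) (huv : u ≠ v) : w = u ∨ w = v := by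
    by_contra! h
    exact htri u v w (hK u v hu hv huv) (hK v w hv hw h.2.symm) (hK u w hu hw h.1.symm)
  have hI3 (u v w) (hu : ¬ K u) (hv : ¬ K v) (hw : ¬ K w) (huv : u ≠ v) : w = u ∨ w = v := by
    by_contra! h
    rcases hanti u v w huv h.2.symm h.1.symm with h | h | h
    exacts [hI _ _ hu hv h, hI _ _ hv hw h, hI _ _ hu hw h]
  by_cases hfour : (∃ k l, K k ∧ K l ∧ k ≠ l) ∧ ∃ i j, ¬ K i ∧ ¬ K j ∧ i ≠ j
  · obtain ⟨⟨k, l, hk, hl, hkl⟩, i, j, hi, hj, hij⟩ := hfour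
    -- The triple `k, i, j` is not independent. Given the edge `k i`, excluding triangles and
    -- independent triples forces the path `i k l j`.
    wlog hki : F.Adj k i generalizing i j
    · refine this j i hj hi hij.symm ?_
      rcases hanti k i j (fun h => hi (h ▸ hk)) hij (fun h => hj (h ▸ hk)) with h | h | h
      exacts [absurd h hki, absurd h (hI _ _ hi hj), h]
    have hkl' := hK k l hk hl hkl
    have hil : ¬ F.Adj i l := fun h => htri k l i hkl' h.symm hki
    have hlj : F.Adj l j := by
      rcases hanti l i j (fun h => hi (h ▸ hl)) hij (fun h => hj (h ▸ hl)) with h | h | h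
      exacts [absurd h.symm hil, absurd h (hI _ _ hi hj), h]
    refine isIndContained_pathGraph_of_four (fun w => ?_) hki.symm hkl' hlj hil (hI _ _ hi hj)
      fun h => htri k l j hkl' hlj h
    by_cases hw : K w
    · have := hK3 k l w hk hl hw hkl
      tauto
    · have := hI3 i j w hi hj hw hij
      tauto
  -- One side now has at most one vertex, so `F` has at most three.
  · by_cases hthree : ∃ x y z : W, x ≠ y ∧ y ≠ z ∧ x ≠ z
    · obtain ⟨x, y, z, hxy, hyz, hxz⟩ := hthree
      have hW (w : W) : w = x ∨ w = y ∨ w = z := by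
        by_cases hx : K x <;> by_cases hy : K y <;> by_cases hz : K z <;> by_cases hw : K w <;>
          grind
      have key (x y z : W) (hW : ∀ w, w = x ∨ w = y ∨ w = z) (hyz : y ≠ z) (hxz : x ≠ z)
          (h : F.Adj x y) : IsIndContained F (pathGraph 4) := by
        by_cases h' : F.Adj x z
        · exact isIndContained_pathGraph_of_three (fun w => by have := hW w; tauto) h.symm hxz hyz
            fun h'' => htri x y z h h'' h'
        · exact isIndContained_pathGraph_of_three hW h hyz hxz h'
      rcases hanti x y z hxy hyz hxz with h | h | h
      · exact key x y z hW hyz hxz h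
      · exact key y z x (fun w => by have := hW w; tauto) hxz.symm hxy.symm h
      · exact key x z y (fun w => by have := hW w; tauto) hyz.symm hxy h
    · rcases isEmpty_or_nonempty W with hemp | ⟨⟨x⟩⟩
      · exact IsIndContained.of_isEmpty
      · by_cases htwo : ∃ y, y ≠ x
        · obtain ⟨y, hy⟩ := htwo
          exact isIndContained_pathGraph_of_two (x := x) (y := y) fun w => by
            by_contra! h
            exact hthree ⟨x, y, w, hy.symm, h.2.symm, h.1.symm⟩
        · push Not at htwo
          exact isIndContained_pathGraph_of_two (x := x) (y := x) fun w => Or.inl (htwo w)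

end SimpleGraph

/-! ### The equivalence -/

theorem isIndContained_of_bounded {d : ℕ} (hd : 2 ≤ d) {W : Type v} {F : SimpleGraph W} {c : ℕ}
    (hc : ∀ (V : Type u) (G : SimpleGraph V), FreeOfDiamAtMost F d V G → cliqueWidth G ≤ c)
    {A V : Type u} [Finite A] [Finite V] (hA : 3 * (c + 1) < Nat.card A) (G : SimpleGraph V)
    (hdiam : G.ediam ≤ 2) (f : A → V) (hf : f.Injective) (g : A → A → V)
    (hfg : ∀ a x y, G.Adj (f a) (g x y) ↔ a = x ∨ a = y) : SimpleGraph.IsIndContained F G := by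
  by_contra hFG
  obtain ⟨a⟩ : Nonempty A := Finite.card_pos_iff.1 (by omega)
  have h := hc V G ⟨inferInstance, ⟨f a⟩, hFG, hdiam.trans (by exact_mod_cast hd)⟩
  exact absurd (card_le_of_cliqueWidth_le h f hf g hfg) (not_le.2 hA)

theorem mainTheorem12 (d : ℕ) (hd : 2 ≤ d) {W : Type v} [Finite W] (F : SimpleGraph W) :
    HasBoundedCliqueWidth.{u} (FreeOfDiamAtMost F d) ↔
      SimpleGraph.IsIndContained F (SimpleGraph.pathGraph 4) := by
  constructor
  · rintro ⟨c, hc⟩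
    -- The summand 2 gives at least five points even when `c = 0`, as the triangle-free graph
    -- requires.
    let A : Type u := ULift (Fin (3 * (c + 1) + 2))
    have hcard : Nat.card A = 3 * (c + 1) + 2 := by simp [A]
    obtain ⟨φ⟩ := isIndContained_of_bounded hd hc (A := A) (by omega)
      (SimpleGraph.triangleFreeIncidence A)
      (SimpleGraph.ediam_triangleFreeIncidence_le A (by omega))
      (fun a => .inl (.inl a)) (Sum.inl_injective.comp Sum.inl_injective)
      (fun x y => .inr (x, y)) fun _ _ _ => Iff.rfl
    have clique (p : Prop) := isIndContained_of_bounded hd hc (A := A) (by omega)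
      (SimpleGraph.cliqueIncidence A p) (SimpleGraph.ediam_cliqueIncidence_le A p)
      Sum.inl Sum.inl_injective (fun x y => .inr (x, y)) fun _ _ _ => Iff.rfl
    obtain ⟨ψ⟩ := clique True
    obtain ⟨χ⟩ := clique False
    refine SimpleGraph.isIndContained_pathGraph_of_split
      (fun u v w huv hvw huw => SimpleGraph.triangleFreeIncidence_not_triangle (φ u) (φ v) (φ w)
        (φ.map_adj_iff.2 huv) (φ.map_adj_iff.2 hvw) (φ.map_adj_iff.2 huw))
      (fun u v w huv hvw huw => by
        simpa only [ψ.map_adj_iff] using SimpleGraph.cliqueIncidence_not_anticlique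
          (ψ u) (ψ v) (ψ w) (ψ.injective.ne huv) (ψ.injective.ne hvw) (ψ.injective.ne huw))
      -- The clique side consists of the vertices sent to pairs in the split graph.
      (fun w => (χ w).isRight) (fun u v hu hv huv => ?_) fun u v hu hv huv => ?_
    · obtain ⟨x, hx⟩ := Sum.isRight_iff.1 hu
      obtain ⟨y, hy⟩ := Sum.isRight_iff.1 hv
      rw [← χ.map_adj_iff, hx, hy]
      rintro rfl
      exact huv (χ.injective (hx.trans hy.symm))
    · rw [Bool.not_eq_true, Sum.isRight_eq_false, Sum.isLeft_iff] at hu hv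
      obtain ⟨x, hx⟩ := hu
      obtain ⟨y, hy⟩ := hv
      rw [← χ.map_adj_iff, hx, hy] at huv
      exact huv.1
  · refine fun hF => ⟨2, fun V G ⟨_, _, hFG, _⟩ => cliqueWidth_le_two
      (SimpleGraph.noInducedPath_of_not_isIndContained fun hP => hFG (hF.trans hP))⟩
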